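/- All Hilbert spaces are finite-dimensional. A system consists of a Hilbert space, a Hamiltonian $H$ (a Hermitian operator) and a density operator $\rho$. Its quantum Fisher information is $F_H(\rho)=2\sum_{j,k}\frac{(p_j-p_k)^2}{p_j+p_k}\,|\langle\phi_j|H|\phi_k\rangle|^2$, where $\rho=\sum_j p_j|\phi_j\rangle\langle\phi_j|$ is a spectral decomposition with $(\phi_j)$ an orthonormal basis, and terms with $p_j=p_k=0$ are omitted. For $t\in\mathbb R$ let $\mathcal U(t)[X]=e^{-iHt}Xe^{iHt}$. Let $(H_{\rm in},\rho)$ be an input system and $(H_{\rm out},\sigma)$ an output system with $F_{H_{\rm out}}(\sigma)>0$, let $\mathcal U_{\rm in}$ and $\mathcal U_{\rm out}$ be their time translations, and let $R>0$. Call a completely positive trace-preserving map $\mathcal E$ from operators on $\mathcal H_{\rm in}^{\otimes n}$ to operators on $\mathcal H_{\rm out}^{\otimes m}$ a TI operation if $\mathcal U_{\rm out}(t)^{\otimes m}\circ\mathcal E=\mathcal E\circ\mathcal U_{\rm in}(t)^{\otimes n}$ for all $t\in\mathbb R$. (a) Let $\delta$ be a real number and suppose there is an integer $n_0$ such that for every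 $n\ge n_0$ there is a TI operation $\mathcal E_n$ from $n$ copies of the input system to $\lceil Rn\rceil$ copies of the output system with $\frac12\big\|\mathcal E_n(\rho^{\otimes n})-\sigma^{\otimes\lceil Rn\rceil}\big\|_1\le\delta$, where $\|\cdot\|_1$ is the sum of the singular values. Then $$g(T)\le 4\sqrt\delta,\qquad T=\frac{F_{H_{\rm in}}(\rho)}{R\,F_{H_{\rm out}}(\sigma)},\qquad g(x)=x^{x/(1-x)}-x^{1/(1-x)}\quad(x\ge 0),$$ where $g(0)=1$ (that is, $0^0=1$) and $g(1)=0$ (the limit of $g$ at $1$). (b) Suppose that the rate $R$ is achievable with vanishing error, that is, there are numbers $\varepsilon_n\to0$ such that for all large $n$ some TI operation sends $\rho^{\otimes n}$ to within trace distance $\varepsilon_n$ of $\sigma^{\otimes\lceil Rn\rceil}$, the trace distance being $\frac12\|\cdot\|_1$ of the difference. Then $$R\le\frac{F_{H_{\rm in}}(\rho)}{F_{H_{\rm out}}(\sigma)}.$$ -/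

import Mathlib

open Filter Topology
open scoped ComplexOrder

noncomputable section

/-!
Finite-dimensional quantum systems.  A system has a Hilbert space `ℂ^d` with a fixed orthonormal
basis indexed by a finite type `d`; operators on it are matrices `Matrix d d ℂ`.  The Hilbert space
of `n` copies has the product basis, indexed by `Fin n → d`.
-/
namespace QuantumIID

/-- Density operators: positive semidefinite with unit trace. -/
def IsDensity {d : Type*} [Fintype d] (ρ : Matrix d d ℂ) : Prop :=
  ρ.PosSemidef ∧ ρ.trace = 1

lemma IsDensity.isHermitian {d : Type*} [Fintype d] {ρ : Matrix d d ℂ} (h : IsDensity ρ) :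
    ρ.IsHermitian :=
  h.1.isHermitian

/-- The tensor power `A ^ {⊗ n}`, as a matrix in the product basis. -/
def tensorPow {d : Type*} (A : Matrix d d ℂ) (n : ℕ) : Matrix (Fin n → d) (Fin n → d) ℂ :=
  Matrix.of fun x y => ∏ i, A (x i) (y i)

/-- The operator `exp (-i t H)`. -/
def timeUnitary {d : Type*} [Fintype d] [DecidableEq d] (H : Matrix d d ℂ) (t : ℝ) :
    Matrix d d ℂ :=
  NormedSpace.exp ((-(Complex.I * (t : ℂ))) • H)

/-- The time translation by `t` of `n` non-interacting copies of a system with Hamiltonian `H`,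
`X ↦ (exp (-i t H)) ^ {⊗ n} X (exp (i t H)) ^ {⊗ n}`. -/
def timeTranslation {d : Type*} [Fintype d] [DecidableEq d] (H : Matrix d d ℂ) (n : ℕ) (t : ℝ)
    (X : Matrix (Fin n → d) (Fin n → d) ℂ) : Matrix (Fin n → d) (Fin n → d) ℂ :=
  tensorPow (timeUnitary H t) n * X * tensorPow (timeUnitary H (-t)) n

/-- The ampliation `id_k ⊗ Φ` of a linear map between matrix algebras. -/
def ampliation {a b : Type*} (k : ℕ) (Φ : Matrix a a ℂ →ₗ[ℂ] Matrix b b ℂ)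
    (X : Matrix (Fin k × a) (Fin k × a) ℂ) : Matrix (Fin k × b) (Fin k × b) ℂ :=
  Matrix.of fun p q => Φ (Matrix.of fun x y => X (p.1, x) (q.1, y)) p.2 q.2

/-- Completely positive trace-preserving linear maps. -/
structure IsCPTP {a b : Type*} [Fintype a] [Fintype b]
    (Φ : Matrix a a ℂ →ₗ[ℂ] Matrix b b ℂ) : Prop where
  completelyPositive : ∀ (k : ℕ) (X : Matrix (Fin k × a) (Fin k × a) ℂ),
    X.PosSemidef → (ampliation k Φ X).PosSemidef
  tracePreserving : ∀ X : Matrix a a ℂ, (Φ X).trace = X.trace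

/-- The trace norm: the sum of the singular values. -/
def traceNorm {d : Type*} [Fintype d] [DecidableEq d] (A : Matrix d d ℂ) : ℝ :=
  ∑ i ∈ Finset.range (Fintype.card d), (Matrix.toEuclideanLin A).singularValues i

/-- The trace distance `‖ρ - σ‖₁ / 2`. -/
def traceDist {d : Type*} [Fintype d] [DecidableEq d] (ρ σ : Matrix d d ℂ) : ℝ :=
  traceNorm (ρ - σ) / 2

/-- The quantum Fisher information of the family `exp (-i t H) ρ exp (i t H)`,
`F_H(ρ) = 2 ∑_{j,k} (p_j - p_k)² / (p_j + p_k) |⟨φ_j| H |φ_k⟩|²`, where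
`ρ = ∑_j p_j |φ_j⟩⟨φ_j|` is a spectral decomposition.  Terms with `p_j = p_k = 0` vanish, which is
also what division by zero gives here. -/
def fisherInfo {d : Type*} [Fintype d] [DecidableEq d] (H ρ : Matrix d d ℂ)
    (hρ : ρ.IsHermitian) : ℝ :=
  2 * ∑ j, ∑ k, (hρ.eigenvalues j - hρ.eigenvalues k) ^ 2 /
      (hρ.eigenvalues j + hρ.eigenvalues k) *
    ‖inner ℂ (hρ.eigenvectorBasis j) (Matrix.toEuclideanLin H (hρ.eigenvectorBasis k))‖ ^ 2

/-- Some CPTP map from `n` copies of the input system to `m` copies of the output system that is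
covariant under time translations (time-translation invariant, TI) sends `ρ ^ {⊗ n}` to within
trace distance `ε` of `σ ^ {⊗ m}`. -/
def TIConvertible {a b : Type*} [Fintype a] [DecidableEq a] [Fintype b] [DecidableEq b]
    (Hin ρ : Matrix a a ℂ) (Hout σ : Matrix b b ℂ) (n m : ℕ) (ε : ℝ) : Prop :=
  ∃ Φ : Matrix (Fin n → a) (Fin n → a) ℂ →ₗ[ℂ] Matrix (Fin m → b) (Fin m → b) ℂ,
    IsCPTP Φ ∧
    (∀ (t : ℝ) (X : Matrix (Fin n → a) (Fin n → a) ℂ),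
      timeTranslation Hout m t (Φ X) = Φ (timeTranslation Hin n t X)) ∧
    traceDist (Φ (tensorPow ρ n)) (tensorPow σ m) ≤ ε

/-- `R` is achievable with vanishing error: TI operations convert `ρ ^ {⊗ n}` to
`σ ^ {⊗ ⌈R n⌉}` with errors `ε n → 0`, for all large `n`. -/
def AchievableRate {a b : Type*} [Fintype a] [DecidableEq a] [Fintype b] [DecidableEq b]
    (Hin ρ : Matrix a a ℂ) (Hout σ : Matrix b b ℂ) (R : ℝ) : Prop :=
  ∃ ε : ℕ → ℝ, Tendsto ε atTop (𝓝 0) ∧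
    ∃ n₀ : ℕ, ∀ n ≥ n₀, TIConvertible Hin ρ Hout σ n ⌈R * (n : ℝ)⌉₊ (ε n)

/-- `g(x) = x^{x/(1-x)} - x^{1/(1-x)}` for `x ≥ 0`.  With the conventions of real powers,
`g 0 = 0^0 - 0^1 = 1`, and `g 1 = 1^0 - 1^0 = 0`, which is the limit of `g` at `1`. -/
def gapFun (x : ℝ) : ℝ :=
  x ^ (x / (1 - x)) - x ^ (1 / (1 - x))

end QuantumIID

end

/-! The proof compares how fast input and output become distinguishable from their time translates
at times `t = s / √n`. On the input side, `exists_purification` gives a purification of `ρ` and an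
ancilla Hamiltonian whose joint energy variance is `F_in / 4`. Its overlap with its own evolution is
`1 - F_in t² / 8 + o(t²)`, so `n` copies have overlap tending to `exp (-s² F_in / 8)`. On the output
side, measuring each copy of `σ` in the eigenbasis of the symmetric logarithmic derivative gives a
Bhattacharyya coefficient at most `1 - F_out t² / 8 + o(t²)`. For `⌈R n⌉` copies the bound tends to
`exp (-R s² F_out / 8)`. A TI operation links the two: covariance makes it send the translated input
to the translated output, and Cauchy–Schwarz outcome by outcome shows that the measured coefficient
is at least the purified overlap (`IsCPTP.norm_trace_le_sum_sqrt`). Replacing the actual outputs by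
`σ` and its translate costs `4 √δ`. With `u = exp (-R s² F_out / 8)` the limit reads `u ^ T - u ≤ 4
√δ` for all `0 < u < 1`. Maximising over `u` gives (a); the single value `u = 1/2` already gives
(b). -/

noncomputable section
namespace QuantumIID
open Matrix

/-! ### Algebra of tensor powers -/

section TensorPow

variable {d : Type*}

lemma tensorPow_conjTranspose (A : Matrix d d ℂ) (n : ℕ) :
    (tensorPow A n)ᴴ = tensorPow Aᴴ n := by
  ext x y
  simp [tensorPow, conjTranspose_apply]

lemma tensorPow_mul [Fintype d] (A B : Matrix d d ℂ) (n : ℕ) :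
    tensorPow A n * tensorPow B n = tensorPow (A * B) n := by
  ext x y
  simp only [tensorPow, mul_apply, of_apply, Finset.prod_univ_sum, Fintype.piFinset_univ,
    Finset.prod_mul_distrib]

lemma trace_tensorPow [Fintype d] (A : Matrix d d ℂ) (n : ℕ) :
    (tensorPow A n).trace = A.trace ^ n := by
  simp only [tensorPow, trace, diag_apply, of_apply]
  rw [← Fin.prod_const, Finset.prod_univ_sum, Fintype.piFinset_univ]

lemma tensorPow_one [DecidableEq d] (n : ℕ) : tensorPow (1 : Matrix d d ℂ) n = 1 := by
  ext x y
  by_cases h : x = y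
  · subst h; simp [tensorPow]
  · obtain ⟨i, hi⟩ := Function.ne_iff.mp h
    simp only [tensorPow, of_apply, one_apply_ne h]
    exact Finset.prod_eq_zero (Finset.mem_univ i) (one_apply_ne hi)

end TensorPow

/-! ### Trace norm dominates measured differences -/

section TraceNorm

/-- Expand `v x` in an eigenbasis of `T† T`, whose image vectors under `T` have the singular values
as norms. Cauchy–Schwarz in `x` and Parseval for `v` then bound each term by one singular value. -/
lemma sum_norm_inner_le_sum_singularValues {ι E : Type*} [Fintype ι] [NormedAddCommGroup E]
    [InnerProductSpace ℂ E] [FiniteDimensional ℂ E] (v : OrthonormalBasis ι ℂ E) (T : E →ₗ[ℂ] E)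
    {n : ℕ} (hn : Module.finrank ℂ E = n) :
    ∑ x, ‖inner ℂ (v x) (T (v x))‖ ≤ ∑ i ∈ Finset.range n, T.singularValues i := by
  let u := T.isSymmetric_adjoint_comp_self.eigenvectorBasis hn
  have hnorm (i : Fin n) : ‖T (u i)‖ = T.singularValues i := by
    rw [← sq_eq_sq₀ (norm_nonneg _) (T.singularValues_nonneg i), T.sq_singularValues_fin hn,
      ← inner_self_eq_norm_sq (𝕜 := ℂ), ← LinearMap.adjoint_inner_left]
    have := T.isSymmetric_adjoint_comp_self.apply_eigenvectorBasis hn i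
    rw [LinearMap.comp_apply] at this
    change RCLike.re (inner ℂ ((LinearMap.adjoint T) (T (u i))) (u i)) = _
    rw [this, inner_smul_left]
    simp [u]
  rw [Finset.sum_range]
  calc ∑ x, ‖inner ℂ (v x) (T (v x))‖
      ≤ ∑ x, ∑ i, ‖inner ℂ (u i) (v x)‖ * ‖inner ℂ (v x) (T (u i))‖ := by
        refine Finset.sum_le_sum fun x _ => ?_
        have : T (v x) = ∑ i, inner ℂ (u i) (v x) • T (u i) := by
          conv_lhs => rw [← u.sum_repr' (v x)]
          simp
        rw [this, inner_sum]
        refine (norm_sum_le _ _).trans (Finset.sum_le_sum fun i _ => ?_)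
        rw [inner_smul_right, norm_mul]
    _ = ∑ i, ∑ x, ‖inner ℂ (u i) (v x)‖ * ‖inner ℂ (v x) (T (u i))‖ := Finset.sum_comm
    _ ≤ ∑ i : Fin n, T.singularValues i := by
        refine Finset.sum_le_sum fun i _ => ?_
        refine (Real.sum_mul_le_sqrt_mul_sqrt _ _ _).trans ?_
        rw [v.sum_sq_norm_inner_left, v.sum_sq_norm_inner_right, ← hnorm]
        simp

variable {d : Type*} [Fintype d] [DecidableEq d]

lemma sum_norm_diag_le_traceNorm (A V : Matrix d d ℂ) (hV : Vᴴ * V = 1) :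
    ∑ x, ‖(Vᴴ * A * V) x x‖ ≤ traceNorm A := by
  let w : d → EuclideanSpace ℂ d := fun x => WithLp.toLp 2 (fun i => V i x)
  have hw (B : Matrix d d ℂ) (x y : d) :
      inner ℂ (w x) (toEuclideanLin B (w y)) = (Vᴴ * B * V) x y := by
    simp only [w, toLpLin_apply, EuclideanSpace.inner_eq_star_dotProduct, Matrix.mul_assoc]
    simp only [mul_apply, dotProduct, mulVec, conjTranspose_apply, Pi.star_apply]
    exact Finset.sum_congr rfl fun i _ => mul_comm _ _
  have hon : Orthonormal ℂ w := by
    rw [orthonormal_iff_ite]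
    intro x y
    have := hw 1 x y
    simp only [Matrix.mul_one, hV, one_apply] at this
    simpa using this
  let v : OrthonormalBasis d ℂ (EuclideanSpace ℂ d) :=
    OrthonormalBasis.mk hon (hon.linearIndependent.span_eq_top_of_card_eq_finrank' (by simp)).ge
  have hv : ∀ x, v x = w x := fun x => by simp [v]
  have := sum_norm_inner_le_sum_singularValues v (toEuclideanLin A) finrank_euclideanSpace
  simp only [hv, hw] at this
  exact this

end TraceNorm

/-! ### Cauchy–Schwarz for positive maps -/

section Positive

variable {a : Type*} [Fintype a]

/-- Cauchy–Schwarz for the semidefinite form `⟨A, B⟩ = l (B * Aᴴ)`. -/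
lemma norm_map_mul_conjTranspose_le (l : Matrix a a ℂ →ₗ[ℂ] ℂ)
    (hl : ∀ X : Matrix a a ℂ, X.PosSemidef → 0 ≤ l X) (A B : Matrix a a ℂ) :
    ‖l (B * Aᴴ)‖ ≤ √(l (A * Aᴴ)).re * √(l (B * Bᴴ)).re := by
  have hpos (X : Matrix a a ℂ) : 0 ≤ l (X * Xᴴ) := hl _ (posSemidef_self_mul_conjTranspose X)
  have him (X : Matrix a a ℂ) : (l (X * Xᴴ)).im = 0 := ((Complex.le_def.1 (hpos X)).2).symm
  have hsymm (A B : Matrix a a ℂ) : star (l (A * Bᴴ)) = l (B * Aᴴ) := by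
    -- Polarisation: realness of `l (X * Xᴴ)` at `A + B` and at `A + i B` forces Hermitian symmetry.
    have h1 := him (A + B)
    have h2 := him (A + Complex.I • B)
    simp only [conjTranspose_add, conjTranspose_smul, Matrix.add_mul, Matrix.mul_add, map_add,
      Matrix.smul_mul, Matrix.mul_smul, map_smul, smul_eq_mul, Complex.add_im, him, Complex.mul_im,
      Complex.mul_re, Complex.add_re, Complex.star_def, Complex.conj_I, Complex.neg_re, Complex.neg_im,
      Complex.I_re, Complex.I_im] at h1 h2
    apply Complex.ext <;> simp only [Complex.star_def, Complex.conj_re, Complex.conj_im] <;>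
      linarith
  let c : PreInnerProductSpace.Core ℂ (Matrix a a ℂ) :=
    { inner := fun A B => l (B * Aᴴ)
      conj_inner_symm := fun A B => hsymm _ _
      re_inner_nonneg := fun A => (Complex.le_def.1 (hpos A)).1
      add_left := fun A B C => by simp [Matrix.mul_add]
      smul_left := fun A B r => by simp }
  have h := @InnerProductSpace.Core.inner_mul_inner_self_le ℂ (Matrix a a ℂ) _ _ _ c A B
  change ‖l (B * Aᴴ)‖ * ‖l (A * Bᴴ)‖ ≤ (l (A * Aᴴ)).re * (l (B * Bᴴ)).re at h
  rw [← hsymm B A, norm_star, ← sq] at h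
  rw [← Real.sqrt_mul (Complex.le_def.1 (hpos A)).1]
  exact Real.le_sqrt_of_sq_le h

variable {b : Type*} [Fintype b]

lemma IsCPTP.posSemidef {Φ : Matrix a a ℂ →ₗ[ℂ] Matrix b b ℂ} (h : IsCPTP Φ) {X : Matrix a a ℂ}
    (hX : X.PosSemidef) : (Φ X).PosSemidef :=
  (h.completelyPositive 1 (X.submatrix Prod.snd Prod.snd) (hX.submatrix _)).submatrix
    (fun y : b => ((0 : Fin 1), y))

/-- Measuring the output of a positive trace-preserving map in an orthonormal basis gives two
distributions whose Bhattacharyya coefficient is at least the overlap of purifications. -/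
lemma IsCPTP.norm_trace_le_sum_sqrt [DecidableEq b] {Φ : Matrix a a ℂ →ₗ[ℂ] Matrix b b ℂ}
    (h : IsCPTP Φ) (V : Matrix b b ℂ) (hV : V * Vᴴ = 1) (A B : Matrix a a ℂ) :
    ‖(B * Aᴴ).trace‖ ≤ ∑ x, √((Vᴴ * Φ (A * Aᴴ) * V) x x).re * √((Vᴴ * Φ (B * Bᴴ) * V) x x).re := by
  let l (x : b) : Matrix a a ℂ →ₗ[ℂ] ℂ :=
    { toFun := fun X => (Vᴴ * Φ X * V) x x
      map_add' := fun X Y => by simp [Matrix.mul_add, Matrix.add_mul]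
      map_smul' := fun r X => by simp }
  have hl (x : b) (X : Matrix a a ℂ) (hX : X.PosSemidef) : 0 ≤ l x X :=
    ((h.posSemidef hX).conjTranspose_mul_mul_same V).diag_nonneg
  have htr : (B * Aᴴ).trace = ∑ x, l x (B * Aᴴ) := by
    change _ = (Vᴴ * Φ (B * Aᴴ) * V).trace
    rw [trace_mul_comm (Vᴴ * _), ← Matrix.mul_assoc, hV, Matrix.one_mul, h.tracePreserving]
  rw [htr]
  exact (norm_sum_le _ _).trans
    (Finset.sum_le_sum fun x _ => norm_map_mul_conjTranspose_le (l x) (hl x) A B)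

end Positive

/-! ### Fisher information as a minimal variance and as the second moment of a score -/

section Fisher

/-- Traces against `ρ` carry the asymmetric weight `p_j`, while the Fisher summand is symmetric in
`j, k`; the two agree only after adding the swapped term. -/
lemma sum_sum_eq_of_add_swap_eq {d : Type*} [Fintype d] {f g : d → d → ℂ}
    (h : ∀ j k, f j k + f k j = g j k + g k j) : ∑ j, ∑ k, f j k = ∑ j, ∑ k, g j k := by
  have h2 (f : d → d → ℂ) : 2 * ∑ j, ∑ k, f j k = ∑ j, ∑ k, (f j k + f k j) := by
    simp only [Finset.sum_add_distrib]
    rw [Finset.sum_comm (f := fun j k => f k j)]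
    ring
  have := h2 f
  simp only [h] at this
  rw [← h2 g] at this
  exact mul_left_cancel₀ two_ne_zero this

lemma mul_swap_of_isHermitian {d : Type*} {A : Matrix d d ℂ} (hA : A.IsHermitian) (j k : d) :
    A j k * A k j = (‖A j k‖ : ℂ) ^ 2 := by
  rw [← hA.apply k j, Complex.star_def, Complex.mul_conj']

variable {d : Type*} [Fintype d]

lemma trace_mul_eq_sum (A B : Matrix d d ℂ) : (A * B).trace = ∑ j, ∑ k, A j k * B k j := by
  simp only [trace, diag_apply, mul_apply]

lemma trace_mul_conj {V : Matrix d d ℂ} (A B : Matrix d d ℂ) :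
    (A * (V * B * Vᴴ)).trace = (Vᴴ * A * V * B).trace := by
  rw [← Matrix.mul_assoc, trace_mul_comm]
  simp only [Matrix.mul_assoc]

variable [DecidableEq d]

lemma trace_mul_mul_diagonal (A B : Matrix d d ℂ) (v : d → ℂ) :
    (A * B * diagonal v).trace = ∑ j, ∑ k, A j k * B k j * v j := by
  simp only [trace, diag_apply, mul_diagonal]
  simp only [mul_apply, Finset.sum_mul]

lemma exists_eigenbasis {ρ : Matrix d d ℂ} (hρ : ρ.IsHermitian) :
    ∃ V : Matrix d d ℂ, Vᴴ * V = 1 ∧ V * Vᴴ = 1 ∧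
      ρ = V * diagonal (fun i => (hρ.eigenvalues i : ℂ)) * Vᴴ ∧
      ∀ H : Matrix d d ℂ, fisherInfo H ρ hρ =
        2 * ∑ j, ∑ k, (hρ.eigenvalues j - hρ.eigenvalues k) ^ 2 /
          (hρ.eigenvalues j + hρ.eigenvalues k) * ‖(Vᴴ * H * V) j k‖ ^ 2 := by
  refine ⟨hρ.eigenvectorUnitary, ?_, ?_, ?_, fun H => ?_⟩
  · exact Unitary.coe_star_mul_self hρ.eigenvectorUnitary
  · exact Unitary.coe_mul_star_self hρ.eigenvectorUnitary
  · have := hρ.spectral_theorem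
    rw [Unitary.conjStarAlgAut_apply] at this
    exact this
  · unfold fisherInfo
    congr! 7 with j _ k _
    rw [toLpLin_apply, EuclideanSpace.inner_eq_star_dotProduct, Matrix.mul_assoc]
    simp only [mul_apply, dotProduct, mulVec, conjTranspose_apply, Pi.star_apply]
    exact Finset.sum_congr rfl fun i _ => mul_comm _ _

lemma fisherInfo_nonneg {H ρ : Matrix d d ℂ} (hρ : IsDensity ρ) :
    0 ≤ fisherInfo H ρ hρ.isHermitian := by
  have hp := hρ.1.eigenvalues_nonneg
  refine mul_nonneg zero_le_two (Finset.sum_nonneg fun j _ => Finset.sum_nonneg fun k _ => ?_)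
  exact mul_nonneg (div_nonneg (sq_nonneg _) (add_nonneg (hp j) (hp k))) (sq_nonneg _)

/-- A purification `W` of `ρ` and a Hamiltonian `K` on the purifying system for which the variance
of the total Hamiltonian is a quarter of the quantum Fisher information of `ρ`. -/
lemma exists_purification {H ρ : Matrix d d ℂ} (hH : H.IsHermitian) (hρ : IsDensity ρ) :
    ∃ W K : Matrix d d ℂ, W * Wᴴ = ρ ∧ K.IsHermitian ∧
      (H * (W * Wᴴ)).trace = (W * K * Wᴴ).trace ∧
      (H * H * (W * Wᴴ)).trace + (W * (K * K) * Wᴴ).trace - 2 * (H * (W * K * Wᴴ)).trace =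
        ((fisherInfo H ρ hρ.isHermitian / 4 : ℝ) : ℂ) := by
  obtain ⟨V, hV, hV', hρV, hF⟩ := exists_eigenbasis hρ.isHermitian
  have hp := hρ.1.eigenvalues_nonneg
  rw [hF]
  set p := hρ.isHermitian.eigenvalues
  set G := Vᴴ * H * V with hG
  have hGh : G.IsHermitian := isHermitian_conjTranspose_mul_mul V hH
  have hGG : Vᴴ * (H * H) * V = G * G := by
    simp only [hG, Matrix.mul_assoc]
    rw [← Matrix.mul_assoc V, hV', Matrix.one_mul]
  let D : Matrix d d ℂ := diagonal fun i => ((√(p i) : ℝ) : ℂ)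
  -- This weight minimises the variance over `K`: the `(j, k)` contribution is quadratic in `K j k`,
  -- with leading weight `(p_j + p_k) / 2` and cross term `2 √p_j √p_k`. The entry is `0` when `p_j
  -- = p_k = 0`.
  let K : Matrix d d ℂ := of fun j k => ((2 * (√(p j) * √(p k)) / (p j + p k) : ℝ) : ℂ) * G j k
  have hDh : Dᴴ = D := by
    simp only [D, diagonal_conjTranspose]
    congr 1; ext i; simp
  have hKh : K.IsHermitian := by
    ext j k
    simp only [K, conjTranspose_apply, of_apply, star_mul', Complex.star_def, Complex.conj_ofReal]
    rw [← Complex.star_def, hGh.apply, mul_comm (√(p k)), add_comm (p k)]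
  have hs (i : d) : ((√(p i) : ℝ) : ℂ) * ((√(p i) : ℝ) : ℂ) = (p i : ℂ) := by
    rw [← Complex.ofReal_mul, Real.mul_self_sqrt (hp i)]
  have hDD : D * D = diagonal fun i => (p i : ℂ) := by
    simp only [D, diagonal_mul_diagonal, hs]
  have hW (X : Matrix d d ℂ) : V * D * X * (V * D)ᴴ = V * (D * X * D) * Vᴴ := by
    rw [conjTranspose_mul, hDh]; simp only [Matrix.mul_assoc]
  have hWW : V * D * (V * D)ᴴ = V * (D * D) * Vᴴ := by
    have := hW 1
    simpa using this
  have hVtr (X : Matrix d d ℂ) : (V * X * Vᴴ).trace = X.trace := by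
    rw [trace_mul_comm, ← Matrix.mul_assoc, hV, Matrix.one_mul]
  refine ⟨V * D, K, ?_, hKh, ?_, ?_⟩
  · rw [hWW, hDD]; exact hρV.symm
  · rw [hWW, hW, hVtr, trace_mul_conj, hDD]
    simp only [trace, diag_apply, mul_diagonal, D, diagonal_mul, K, of_apply]
    refine Finset.sum_congr rfl fun i _ => ?_
    rw [← hG, mul_right_comm, ← mul_assoc, hs, Real.mul_self_sqrt (hp i)]
    rcases (hp i).eq_or_lt with h | h
    · simp [← h]
    · have : (p i : ℂ) ≠ 0 := by exact_mod_cast h.ne'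
      push_cast
      field_simp
      ring
  · rw [hWW, hW, hW, hVtr, trace_mul_conj, trace_mul_conj, hDD, hGG, ← hG,
      trace_mul_mul_diagonal, Matrix.mul_assoc D, trace_mul_comm D, Matrix.mul_assoc _ D D, hDD,
      trace_mul_mul_diagonal, trace_mul_eq_sum]
    simp only [D, mul_diagonal, diagonal_mul, Finset.mul_sum, ← Finset.sum_add_distrib, ← Finset.sum_sub_distrib, Complex.ofReal_sum,
      Complex.ofReal_div, Complex.ofReal_mul, Finset.sum_div]
    refine sum_sum_eq_of_add_swap_eq fun j k => ?_
    have e1 := mul_swap_of_isHermitian hGh j k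
    have hn : ‖G k j‖ = ‖G j k‖ := by rw [← hGh.apply, norm_star]
    have hjk := hs j
    have hkk := hs k
    simp only [K, of_apply, hn]
    push_cast
    generalize ((√(p j) : ℝ) : ℂ) = sj at *
    generalize ((√(p k) : ℝ) : ℂ) = sk at *
    rcases (add_nonneg (hp j) (hp k)).eq_or_lt with h | h
    · have h1 : p j = 0 := by linarith [hp j, hp k]
      have h2 : p k = 0 := by linarith [hp j, hp k]
      simp [h1, h2]
    · have hne : (p j : ℂ) + (p k : ℂ) ≠ 0 := by exact_mod_cast h.ne'
      rw [← hjk, ← hkk, ← sq, ← sq] at hne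
      rw [← e1, ← hjk, ← hkk]
      generalize G j k = x
      generalize G k j = y
      rw [add_comm (sk * sk) (sj * sj)]
      field_simp
      ring

/-- The symmetric logarithmic derivative `L` of `σ` along the time translation. -/
lemma exists_symmetric_logarithmic_derivative {H σ : Matrix d d ℂ} (hH : H.IsHermitian)
    (hσ : IsDensity σ) :
    ∃ L : Matrix d d ℂ, L.IsHermitian ∧ (L * σ).trace = 0 ∧
      (L * L * σ).trace = (fisherInfo H σ hσ.isHermitian : ℂ) ∧
      (L * (-Complex.I • (H * σ - σ * H))).trace = (fisherInfo H σ hσ.isHermitian : ℂ) := by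
  obtain ⟨V, hV, hV', hσV, hF⟩ := exists_eigenbasis hσ.isHermitian
  have hp := hσ.1.eigenvalues_nonneg
  rw [hF]
  set p := hσ.isHermitian.eigenvalues
  set G := Vᴴ * H * V with hG
  have hGh : G.IsHermitian := isHermitian_conjTranspose_mul_mul V hH
  let P : Matrix d d ℂ := diagonal fun i => (p i : ℂ)
  -- Entrywise solution of `(L σ + σ L) / 2 = -i [H, σ]` in the eigenbasis of `σ`, set to `0` where
  -- `p_j + p_k = 0`.
  let L : Matrix d d ℂ := of fun j k => -2 * Complex.I * (((p k - p j) / (p j + p k) : ℝ) : ℂ) * G j k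
  have hσP : σ = V * P * Vᴴ := hσV
  have hLh : L.IsHermitian := by
    ext j k
    simp only [L, conjTranspose_apply, of_apply, star_mul', Complex.star_def, Complex.conj_ofReal,
      Complex.conj_I, map_neg, map_ofNat]
    rw [← Complex.star_def, hGh.apply, add_comm (p k), ← neg_sub (p k) (p j), neg_div]
    push_cast
    ring
  have hVL : Vᴴ * (V * L * Vᴴ) * V = L := by
    simp only [Matrix.mul_assoc, hV, Matrix.mul_one]
    rw [← Matrix.mul_assoc, hV, Matrix.one_mul]
  have hVLL : Vᴴ * ((V * L * Vᴴ) * (V * L * Vᴴ)) * V = L * L := by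
    simp only [Matrix.mul_assoc, hV, Matrix.mul_one]
    rw [← Matrix.mul_assoc, hV, Matrix.one_mul, ← Matrix.mul_assoc Vᴴ, hV, Matrix.one_mul]
  have hcomm : H * σ - σ * H = V * (G * P - P * G) * Vᴴ := by
    rw [Matrix.mul_sub, Matrix.sub_mul, hσP, hG]
    simp only [Matrix.mul_assoc]
    rw [hV', Matrix.mul_one, ← Matrix.mul_assoc V Vᴴ, hV', Matrix.one_mul]
  have hdiag (j : d) : L j j = 0 := by simp [L]
  refine ⟨V * L * Vᴴ, isHermitian_mul_mul_conjTranspose V hLh, ?_, ?_, ?_⟩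
  · rw [hσP, trace_mul_conj, hVL]
    simp [trace, P, mul_diagonal, hdiag]
  · rw [hσP, trace_mul_conj, hVLL, trace_mul_mul_diagonal]
    simp only [Finset.mul_sum, Complex.ofReal_sum, Complex.ofReal_mul]
    refine sum_sum_eq_of_add_swap_eq fun j k => ?_
    have e1 := mul_swap_of_isHermitian hGh j k
    have hn : ‖G k j‖ = ‖G j k‖ := by rw [← hGh.apply, norm_star]
    simp only [L, of_apply, hn]
    push_cast
    rcases (add_nonneg (hp j) (hp k)).eq_or_lt with h | h
    · have h1 : p j = 0 := by linarith [hp j, hp k]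
      have h2 : p k = 0 := by linarith [hp j, hp k]
      simp [h1, h2]
    · have hne : (p j : ℂ) + (p k : ℂ) ≠ 0 := by exact_mod_cast h.ne'
      rw [add_comm (p k : ℂ) (p j : ℂ), ← e1]
      field_simp
      ring_nf
      simp only [Complex.I_sq]
      ring
  · rw [hcomm, Matrix.mul_smul, trace_smul, trace_mul_conj, hVL, trace_mul_eq_sum]
    simp only [mul_diagonal, diagonal_mul, P, Matrix.sub_apply, Finset.mul_sum, Complex.ofReal_sum, Complex.ofReal_mul, smul_eq_mul]
    refine Finset.sum_congr rfl fun j _ => Finset.sum_congr rfl fun k _ => ?_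
    have e1 := mul_swap_of_isHermitian hGh j k
    simp only [L, of_apply]
    push_cast
    rw [← e1]
    simp only [div_eq_mul_inv]
    ring_nf
    simp only [Complex.I_sq]
    ring

end Fisher

/-! ### Second-order expansions in time -/

section Expansion

lemma tendsto_exp_second_order {𝔸 : Type*} [NormedRing 𝔸] [NormedAlgebra ℂ 𝔸] [CompleteSpace 𝔸]
    (A : 𝔸) :
    Tendsto (fun t : ℝ => ((t : ℂ) ^ 2)⁻¹ • (NormedSpace.exp ((t : ℂ) • A) - 1 - (t : ℂ) • A))
      (𝓝[≠] 0) (𝓝 ((2⁻¹ : ℂ) • (A * A))) := by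
  have h1 := (NormedSpace.exp_hasFPowerSeriesAt_zero (𝕂 := ℂ) (𝔸 := 𝔸)).isBigO_sub_partialSum_pow 3
  have ht : Tendsto (fun t : ℝ => (t : ℂ) • A) (𝓝[≠] 0) (𝓝 0) := by
    have : Tendsto (fun t : ℝ => (t : ℂ) • A) (𝓝 0) (𝓝 (((0 : ℝ) : ℂ) • A)) :=
      Continuous.tendsto (by fun_prop) 0
    simp only [Complex.ofReal_zero, zero_smul] at this
    exact this.mono_left nhdsWithin_le_nhds
  obtain ⟨C, hC⟩ := (h1.comp_tendsto ht).bound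
  rw [tendsto_iff_norm_sub_tendsto_zero]
  have hb : Tendsto (fun t : ℝ => C * (|t| * ‖A‖ ^ 3)) (𝓝[≠] 0) (𝓝 0) := by
    have : Tendsto (fun t : ℝ => C * (|t| * ‖A‖ ^ 3)) (𝓝 0) (𝓝 (C * (|0| * ‖A‖ ^ 3))) :=
      Continuous.tendsto (by fun_prop) 0
    simp only [abs_zero, zero_mul, mul_zero] at this
    exact this.mono_left nhdsWithin_le_nhds
  refine squeeze_zero' (Eventually.of_forall fun _ => norm_nonneg _) ?_ hb
  filter_upwards [hC, self_mem_nhdsWithin] with t hbt hne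
  have htc : (t : ℂ) ≠ 0 := by exact_mod_cast hne
  have habs : 0 < |t| := abs_pos.2 hne
  simp only [Function.comp_apply, zero_add, FormalMultilinearSeries.partialSum,
    NormedSpace.expSeries_apply_eq, Finset.sum_range_succ, Finset.sum_range_zero, norm_smul,
    Complex.norm_real, Real.norm_eq_abs, norm_pow, abs_mul,
    abs_abs, abs_norm] at hbt
  have e : ((t : ℂ) ^ 2)⁻¹ • (NormedSpace.exp ((t : ℂ) • A) - 1 - (t : ℂ) • A) -
      (2⁻¹ : ℂ) • (A * A) = ((t : ℂ) ^ 2)⁻¹ • (NormedSpace.exp ((t : ℂ) • A) -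
        (((Nat.factorial 0 : ℂ)⁻¹) • ((t : ℂ) • A) ^ 0 + ((Nat.factorial 1 : ℂ)⁻¹) • ((t : ℂ) • A) ^ 1
          + ((Nat.factorial 2 : ℂ)⁻¹) • ((t : ℂ) • A) ^ 2)) := by
    have : (2⁻¹ : ℂ) • (A * A) = ((t : ℂ) ^ 2)⁻¹ • ((2⁻¹ : ℂ) • ((t : ℂ) ^ 2 • (A * A))) := by
      rw [smul_comm (2⁻¹ : ℂ), inv_smul_smul₀ (pow_ne_zero 2 htc)]
    rw [this, ← smul_sub]
    congr 1
    rw [smul_pow _ A 2, sq A, pow_zero, pow_one, Nat.factorial_zero, Nat.factorial_one,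
      Nat.factorial_two, Nat.cast_one, inv_one, one_smul, one_smul, Nat.cast_ofNat]
    abel
  rw [e, norm_smul, norm_inv, norm_pow, Complex.norm_real, Real.norm_eq_abs,
    inv_mul_le_iff₀ (by positivity)]
  calc _ ≤ C * (|t| * ‖A‖) ^ 3 := hbt
    _ = _ := by ring

variable {d : Type*} [Fintype d] [DecidableEq d]

lemma tendsto_timeUnitary_second_order (H : Matrix d d ℂ) :
    Tendsto (fun t : ℝ => ((t : ℂ) ^ 2)⁻¹ • (timeUnitary H t - 1 - (t : ℂ) • (-Complex.I • H)))
      (𝓝[≠] 0) (𝓝 ((2⁻¹ : ℂ) • ((-Complex.I • H) * (-Complex.I • H)))) := by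
  open scoped Norms.Operator in
  have := tendsto_exp_second_order (-Complex.I • H)
  refine this.congr fun t => ?_
  rw [timeUnitary, smul_smul, mul_neg, mul_comm]
  rfl

lemma timeUnitary_neg (H : Matrix d d ℂ) (t : ℝ) : timeUnitary H (-t) = timeUnitary (-H) t := by
  simp [timeUnitary]

lemma timeUnitary_zero (H : Matrix d d ℂ) : timeUnitary H 0 = 1 := by
  open scoped Norms.Operator in
  simp [timeUnitary]

lemma timeUnitary_conjTranspose {H : Matrix d d ℂ} (hH : H.IsHermitian) (t : ℝ) :
    (timeUnitary H t)ᴴ = timeUnitary H (-t) := by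
  rw [timeUnitary, timeUnitary, ← exp_conjTranspose]
  simp [hH.eq]

lemma timeUnitary_mul_neg (H : Matrix d d ℂ) (t : ℝ) :
    timeUnitary H t * timeUnitary H (-t) = 1 := by
  have h : timeUnitary H (-t) = (timeUnitary H t)⁻¹ := by
    rw [timeUnitary, timeUnitary, ← Matrix.exp_neg]
    simp
  rw [h]
  exact Matrix.mul_nonsing_inv _ ((Matrix.isUnit_iff_isUnit_det _).1 (Matrix.isUnit_exp _))

/-- Testing against a linear functional keeps the statement free of a choice of matrix norm. -/
lemma hasDerivAt_timeUnitary_zero (H : Matrix d d ℂ) (D : Matrix d d ℂ →ₗ[ℂ] ℂ) (σ : Matrix d d ℂ) :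
    HasDerivAt (fun t : ℝ => D (timeUnitary H t * σ * timeUnitary H (-t)))
      (D (-Complex.I • (H * σ - σ * H))) 0 := by
  open scoped Norms.Operator in
  have h1 (H : Matrix d d ℂ) : HasDerivAt (fun t : ℝ => timeUnitary H t) (-Complex.I • H) 0 := by
    have := hasDerivAt_exp_smul_const (𝕂 := ℝ) (-Complex.I • H) 0
    simp only [zero_smul, NormedSpace.exp_zero, one_mul] at this
    refine this.congr_of_eventuallyEq (Eventually.of_forall fun t => ?_)
    change timeUnitary H t = _
    rw [timeUnitary]
    congr 1
    ext i j
    simp [Complex.real_smul]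
    ring
  open scoped Norms.Operator in
  have h2 := ((h1 H).mul_const σ).mul (h1 (-H))
  open scoped Norms.Operator in
  have h3 := (D.restrictScalars ℝ).toContinuousLinearMap.hasFDerivAt.comp_hasDerivAt (0 : ℝ) h2
  have h4 : -Complex.I • (H * σ - σ * H) =
      -Complex.I • H * σ * timeUnitary (-H) 0 + timeUnitary H 0 * σ * (-Complex.I • -H) := by
    simp [timeUnitary_zero, sub_eq_add_neg]
  rw [h4]
  simp only [timeUnitary_neg]
  exact h3

/-- The vector `W` evolves under `X ↦ H X - X K`. Its mean energy vanishes by `h2`, killing the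
linear term; the quadratic term is minus half the variance `F / 4`. -/
lemma tendsto_overlap_second_order {H K W : Matrix d d ℂ} {F : ℝ} (h1 : (W * Wᴴ).trace = 1)
    (h2 : (H * (W * Wᴴ)).trace = (W * K * Wᴴ).trace)
    (h3 : (H * H * (W * Wᴴ)).trace + (W * (K * K) * Wᴴ).trace - 2 * (H * (W * K * Wᴴ)).trace =
        ((F / 4 : ℝ) : ℂ)) :
    Tendsto (fun t : ℝ => ((t : ℂ) ^ 2)⁻¹ *
      ((timeUnitary H t * W * timeUnitary K (-t) * Wᴴ).trace - 1)) (𝓝[≠] 0)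
      (𝓝 ((-F / 8 : ℝ) : ℂ)) := by
  set A := -Complex.I • H with hA
  set B := -Complex.I • (-K) with hB
  have hX := tendsto_timeUnitary_second_order H
  have hY := tendsto_timeUnitary_second_order (-K)
  rw [← hA] at hX
  rw [← hB] at hY
  have ht : Tendsto (fun t : ℝ => (t : ℂ)) (𝓝[≠] 0) (𝓝 0) := by
    have : Tendsto (fun t : ℝ => (t : ℂ)) (𝓝 0) (𝓝 ((0 : ℝ) : ℂ)) :=
      Complex.continuous_ofReal.tendsto 0
    rw [Complex.ofReal_zero] at this
    exact this.mono_left nhdsWithin_le_nhds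
  -- The rescaled overlap is a polynomial in `t` and the rescaled second-order remainders of the two
  -- exponentials, so continuity gives the limit.
  let Q : ℂ × Matrix d d ℂ × Matrix d d ℂ → ℂ := fun p =>
    (p.2.1 * (W * Wᴴ)).trace + (A * (W * B * Wᴴ)).trace + (W * p.2.2 * Wᴴ).trace +
      p.1 * ((p.2.1 * (W * B * Wᴴ)).trace + (A * (W * p.2.2 * Wᴴ)).trace) +
      p.1 ^ 2 * (p.2.1 * (W * p.2.2 * Wᴴ)).trace
  have hQ : Continuous Q := by fun_prop
  have hlim := (hQ.tendsto _).comp (ht.prodMk_nhds (hX.prodMk_nhds hY))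
  have hval : Q (0, (2⁻¹ : ℂ) • (A * A), (2⁻¹ : ℂ) • (B * B)) = ((-F / 8 : ℝ) : ℂ) := by
    have : ((-F / 8 : ℝ) : ℂ) = -2⁻¹ * ((F / 4 : ℝ) : ℂ) := by push_cast; ring
    rw [this, ← h3]
    simp only [Q, hA, hB, Matrix.smul_mul, Matrix.mul_smul, smul_smul, trace_smul, smul_eq_mul,
      Complex.I_mul_I, smul_neg, Matrix.neg_mul, trace_neg, neg_smul,
      neg_neg, mul_neg, zero_mul]
    ring_nf
  rw [hval] at hlim
  refine hlim.congr' ?_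
  filter_upwards [self_mem_nhdsWithin] with t hne
  have htc : (t : ℂ) ≠ 0 := by exact_mod_cast hne
  have hsplit (G C : Matrix d d ℂ) : G = 1 + (t : ℂ) • C +
      (t : ℂ) ^ 2 • (((t : ℂ) ^ 2)⁻¹ • (G - 1 - (t : ℂ) • C)) := by
    rw [smul_inv_smul₀ (pow_ne_zero 2 htc)]; abel
  simp only [Function.comp_apply, Q]
  rw [timeUnitary_neg]
  have hU := hsplit (timeUnitary H t) A
  have hE := hsplit (timeUnitary (-K) t) B
  generalize ((t : ℂ) ^ 2)⁻¹ • (timeUnitary H t - 1 - (t : ℂ) • A) = X at *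
  generalize ((t : ℂ) ^ 2)⁻¹ • (timeUnitary (-K) t - 1 - (t : ℂ) • B) = Y at *
  have hAB : (A * (W * Wᴴ)).trace + (W * B * Wᴴ).trace = 0 := by
    simp only [hA, hB, Matrix.smul_mul, Matrix.mul_smul, trace_smul, smul_eq_mul, h2,
      Matrix.mul_neg, Matrix.neg_mul, trace_neg]
    ring
  rw [hU, hE, eq_inv_mul_iff_mul_eq₀ (pow_ne_zero 2 htc)]
  simp only [Matrix.add_mul, Matrix.mul_add, Matrix.one_mul, Matrix.mul_one, Matrix.smul_mul,
    Matrix.mul_smul, trace_add, trace_smul, smul_eq_mul, Matrix.mul_assoc] at h1 hAB ⊢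
  linear_combination (-1) * h1 - (t : ℂ) * hAB

/-- Bhattacharyya coefficients along a curve of distributions decay at least as fast as the
Fisher information about any score function `s` dictates. -/
lemma exists_bhattacharyya_bound {ι : Type*} [Fintype ι] {q : ℝ → ι → ℝ} {s : ι → ℝ} {F : ℝ}
    (hq : ∀ t x, 0 ≤ q t x) (hq1 : ∀ t, ∑ x, q t x = 1)
    (hc : ∀ x, ContinuousAt (fun t => q t x) 0) (h1 : ∑ x, q 0 x * s x = 0)
    (h2 : ∑ x, q 0 x * s x ^ 2 = F) (hd : HasDerivAt (fun t => ∑ x, q t x * s x) F 0) :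
    ∃ ψ : ℝ → ℝ, (∀ᶠ t in 𝓝[≠] 0, ∑ x, √(q 0 x) * √(q t x) ≤ 1 + t ^ 2 * ψ t) ∧
      Tendsto ψ (𝓝[≠] 0) (𝓝 (-F / 8)) := by
  -- Comes from `2 √(q₀ q_t) ≤ q₀ y + q_t / y` with `y = 1 + s t / 2`, the first-order guess for
  -- `√(q_t / q₀)`, and the exact identity `1 / y = 1 - s t / 2 + (s t)² / (4 y)`. Outcomes with `q₀
  -- = 0` need no separate treatment. The limit is `-F / 4 + F / 8`.
  refine ⟨fun t => -4⁻¹ * (t⁻¹ * ∑ x, q t x * s x) +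
    8⁻¹ * ∑ x, q t x * s x ^ 2 / (1 + s x * t / 2), ?_, ?_⟩
  · have hev : ∀ᶠ t in 𝓝[≠] (0 : ℝ), ∀ x, 0 < 1 + s x * t / 2 := by
      rw [eventually_all]
      intro x
      have : Tendsto (fun t : ℝ => 1 + s x * t / 2) (𝓝 0) (𝓝 (1 + s x * 0 / 2)) :=
        Continuous.tendsto (by fun_prop) 0
      exact (this.mono_left nhdsWithin_le_nhds).eventually (lt_mem_nhds (by norm_num))
    filter_upwards [hev, self_mem_nhdsWithin] with t hpos hne
    have hne : t ≠ 0 := hne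
    have hterm (x : ι) : √(q 0 x) * √(q t x) ≤
        (q 0 x + t / 2 * (q 0 x * s x) + (q t x - t / 2 * (q t x * s x) +
          t ^ 2 / 4 * (q t x * s x ^ 2 / (1 + s x * t / 2)))) / 2 := by
      have hy := hpos x
      set y := 1 + s x * t / 2 with hydef
      have e : q 0 x + t / 2 * (q 0 x * s x) + (q t x - t / 2 * (q t x * s x) +
          t ^ 2 / 4 * (q t x * s x ^ 2 / y)) = √(q 0 x) ^ 2 * y + √(q t x) ^ 2 / y := by
        rw [Real.sq_sqrt (hq 0 x), Real.sq_sqrt (hq t x)]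
        field_simp
        rw [hydef]
        ring
      rw [e, le_div_iff₀ two_pos]
      have hy' : √y ≠ 0 := (Real.sqrt_pos.2 hy).ne'
      have := two_mul_le_add_sq (√(q 0 x) * √y) (√(q t x) / √y)
      rw [mul_pow, div_pow, Real.sq_sqrt hy.le] at this
      calc _ = 2 * (√(q 0 x) * √y) * (√(q t x) / √y) := by field_simp
        _ ≤ _ := this
    refine (Finset.sum_le_sum fun x _ => hterm x).trans_eq ?_
    rw [← Finset.sum_div]
    simp only [Finset.sum_add_distrib, Finset.sum_sub_distrib, ← Finset.mul_sum, hq1, h1]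
    field_simp
    ring
  · have hs := hd.tendsto_slope_zero
    simp only [zero_add, h1, sub_zero, smul_eq_mul] at hs
    have hr : Tendsto (fun t => ∑ x, q t x * s x ^ 2 / (1 + s x * t / 2)) (𝓝 0)
        (𝓝 (∑ x, q 0 x * s x ^ 2 / (1 + s x * 0 / 2))) := by
      refine tendsto_finsetSum _ fun x _ => Tendsto.div ((hc x).tendsto.mul_const _) ?_ (by simp)
      exact Continuous.tendsto (by fun_prop) 0
    simp only [mul_zero, zero_div, add_zero, div_one, h2] at hr
    have := (hs.const_mul (-4⁻¹)).add ((hr.mono_left nhdsWithin_le_nhds).const_mul 8⁻¹)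
    convert this using 2
    ring

end Expansion

/-! ### From a TI conversion to an inequality between overlaps -/

section Conversion

/-- Bhattacharyya coefficients are continuous in total variation distance. -/
lemma sum_sqrt_mul_sqrt_le_add {ι : Type*} [Fintype ι] {P P' Q Q' : ι → ℝ} {ε : ℝ}
    (hP : ∀ x, 0 ≤ P x) (hP' : ∀ x, 0 ≤ P' x) (hQ : ∀ x, 0 ≤ Q x) (hQ' : ∀ x, 0 ≤ Q' x)
    (hP1 : ∑ x, P' x = 1) (hQ1 : ∑ x, Q x = 1) (h : ∑ x, |P x - Q x| ≤ 2 * ε)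
    (h' : ∑ x, |P' x - Q' x| ≤ 2 * ε) :
    ∑ x, √(P x) * √(P' x) ≤ ∑ x, √(Q x) * √(Q' x) + 4 * √ε := by
  have hel {p q : ℝ} (hp : 0 ≤ p) (hq : 0 ≤ q) : (√p - √q) ^ 2 ≤ |p - q| := by
    have e : p - q = (√p - √q) * (√p + √q) := by
      nlinarith [Real.sq_sqrt hp, Real.sq_sqrt hq]
    rw [e, abs_mul, ← sq_abs, sq]
    refine mul_le_mul_of_nonneg_left ?_ (abs_nonneg _)
    rw [abs_of_nonneg (add_nonneg (Real.sqrt_nonneg p) (Real.sqrt_nonneg q))]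
    exact abs_le.2 ⟨by linarith [Real.sqrt_nonneg p], by linarith [Real.sqrt_nonneg q]⟩
  -- Each of the two replacements costs `√(2 ε)`; rounding `√2` up to `2` produces the constant `4`.
  have hb : √(2 * ε) ≤ 2 * √ε := by
    rw [Real.sqrt_mul zero_le_two]
    refine mul_le_mul_of_nonneg_right ?_ (Real.sqrt_nonneg _)
    exact (Real.sqrt_le_left zero_le_two).2 (by norm_num)
  have h1 : ∑ x, (√(P x) - √(Q x)) * √(P' x) ≤ 2 * √ε := by
    refine (Real.sum_mul_le_sqrt_mul_sqrt _ _ _).trans (le_trans ?_ hb)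
    simp only [Real.sq_sqrt (hP' _), hP1, Real.sqrt_one, mul_one]
    exact Real.sqrt_le_sqrt ((Finset.sum_le_sum fun x _ => hel (hP x) (hQ x)).trans h)
  have h2 : ∑ x, (√(P' x) - √(Q' x)) * √(Q x) ≤ 2 * √ε := by
    refine (Real.sum_mul_le_sqrt_mul_sqrt _ _ _).trans (le_trans ?_ hb)
    simp only [Real.sq_sqrt (hQ _), hQ1, Real.sqrt_one, mul_one]
    exact Real.sqrt_le_sqrt ((Finset.sum_le_sum fun x _ => hel (hP' x) (hQ' x)).trans h')
  have h3 : ∑ x, √(P x) * √(P' x) = ∑ x, √(Q x) * √(Q' x) +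
      (∑ x, (√(P x) - √(Q x)) * √(P' x) + ∑ x, (√(P' x) - √(Q' x)) * √(Q x)) := by
    simp only [← Finset.sum_add_distrib]
    exact Finset.sum_congr rfl fun x _ => by ring
  linarith

lemma sum_sqrt_diag_tensorPow {d : Type*} [Fintype d] {A B : Matrix d d ℂ}
    (hA : A.PosSemidef) (hB : B.PosSemidef) (m : ℕ) :
    ∑ y, √(tensorPow A m y y).re * √(tensorPow B m y y).re =
      (∑ x, √(A x x).re * √(B x x).re) ^ m := by
  have h {A : Matrix d d ℂ} (hA : A.PosSemidef) (y : Fin m → d) :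
      √(tensorPow A m y y).re = ∏ i, √(A (y i) (y i)).re := by
    have hre (x : d) : A x x = (((A x x).re : ℝ) : ℂ) :=
      Complex.ext (by simp) (by simpa using ((Complex.le_def.1 (hA.diag_nonneg (i := x))).2).symm)
    have : tensorPow A m y y = ((∏ i, (A (y i) (y i)).re : ℝ) : ℂ) := by
      rw [Complex.ofReal_prod, tensorPow, of_apply]
      exact Finset.prod_congr rfl fun i _ => hre _
    rw [this, Complex.ofReal_re]
    exact Real.sqrt_prod _ fun i _ => (Complex.le_def.1 hA.diag_nonneg).1
  rw [← Fin.prod_const, Finset.prod_univ_sum, Fintype.piFinset_univ]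
  simp only [h hA, h hB, Finset.prod_mul_distrib]

open scoped MatrixOrder Matrix.Norms.L2Operator in
lemma posSemidef_tensorPow {d : Type*} [Fintype d] {A : Matrix d d ℂ} (hA : A.PosSemidef)
    (n : ℕ) : (tensorPow A n).PosSemidef := by
  classical
  obtain ⟨B, rfl⟩ := CStarAlgebra.nonneg_iff_eq_star_mul_self.mp hA.nonneg
  rw [star_eq_conjTranspose, ← tensorPow_mul, ← tensorPow_conjTranspose]
  exact posSemidef_conjTranspose_mul_self _

lemma sum_abs_re_diag_sub_le {d : Type*} [Fintype d] [DecidableEq d] {X Y V : Matrix d d ℂ} {ε : ℝ}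
    (hV : Vᴴ * V = 1) (h : traceDist X Y ≤ ε) :
    ∑ y, |((Vᴴ * X * V) y y).re - ((Vᴴ * Y * V) y y).re| ≤ 2 * ε := by
  have h1 := sum_norm_diag_le_traceNorm (X - Y) V hV
  unfold traceDist at h
  refine le_trans (Finset.sum_le_sum fun y _ => ?_) (h1.trans (by linarith))
  rw [Matrix.mul_sub, Matrix.sub_mul, Matrix.sub_apply, ← Complex.sub_re]
  exact Complex.abs_re_le_norm _

lemma timeTranslation_tensorPow {d : Type*} [Fintype d] [DecidableEq d] (H A : Matrix d d ℂ)
    (n : ℕ) (t : ℝ) : timeTranslation H n t (tensorPow A n) =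
      tensorPow (timeUnitary H t * A * timeUnitary H (-t)) n := by
  simp only [timeTranslation, tensorPow_mul]

lemma re_trace_conj {d : Type*} [Fintype d] [DecidableEq d] {V : Matrix d d ℂ} (hV : V * Vᴴ = 1)
    (X : Matrix d d ℂ) : ∑ x, ((Vᴴ * X * V) x x).re = X.trace.re := by
  rw [← Complex.re_sum]
  change (Vᴴ * X * V).trace.re = _
  rw [trace_mul_comm, ← Matrix.mul_assoc, hV, Matrix.one_mul]

lemma posSemidef_timeUnitary_conj {d : Type*} [Fintype d] [DecidableEq d] {H X : Matrix d d ℂ}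
    (hH : H.IsHermitian) (hX : X.PosSemidef) (t : ℝ) :
    (timeUnitary H t * X * timeUnitary H (-t)).PosSemidef := by
  rw [← timeUnitary_conjTranspose hH]
  exact hX.mul_mul_conjTranspose_same _

lemma trace_timeUnitary_conj {d : Type*} [Fintype d] [DecidableEq d] (H X : Matrix d d ℂ) (t : ℝ) :
    (timeUnitary H t * X * timeUnitary H (-t)).trace = X.trace := by
  have := timeUnitary_mul_neg H (-t)
  rw [neg_neg] at this
  rw [trace_mul_comm, ← Matrix.mul_assoc, this, Matrix.one_mul]

variable {a b : Type*} [Fintype a] [DecidableEq a] [Fintype b] [DecidableEq b]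

/-- A TI conversion turns the overlap of `n` purified inputs, up to the error, into a lower bound
for the Bhattacharyya coefficient of any product measurement of the outputs. -/
lemma TIConvertible.norm_overlap_pow_le {Hin ρ W K : Matrix a a ℂ} {Hout σ M : Matrix b b ℂ}
    {n m : ℕ} {ε : ℝ} (h : TIConvertible Hin ρ Hout σ n m ε) (hHin : Hin.IsHermitian)
    (hHout : Hout.IsHermitian) (hρ : IsDensity ρ) (hσ : IsDensity σ) (hW : W * Wᴴ = ρ)
    (hK : K.IsHermitian) (hM : Mᴴ * M = 1) (hM' : M * Mᴴ = 1) (t : ℝ) :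
    ‖(timeUnitary Hin t * W * timeUnitary K (-t) * Wᴴ).trace‖ ^ n ≤
      (∑ x, √((Mᴴ * σ * M) x x).re *
        √((Mᴴ * (timeUnitary Hout t * σ * timeUnitary Hout (-t)) * M) x x).re) ^ m + 4 * √ε := by
  obtain ⟨Φ, hΦ, hcov, hdist⟩ := h
  set V := tensorPow M m with hVdef
  have hVV : Vᴴ * V = 1 := by
    rw [hVdef, tensorPow_conjTranspose, tensorPow_mul, hM, tensorPow_one]
  have hVV' : V * Vᴴ = 1 := by
    rw [hVdef, tensorPow_conjTranspose, tensorPow_mul, hM', tensorPow_one]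
  have hdiag (X : Matrix b b ℂ) : Vᴴ * tensorPow X m * V = tensorPow (Mᴴ * X * M) m := by
    rw [hVdef, tensorPow_conjTranspose, tensorPow_mul, tensorPow_mul]
  clear_value V
  set C := timeUnitary Hin t * W * timeUnitary K (-t) with hC
  have hCC : C * Cᴴ = timeUnitary Hin t * ρ * timeUnitary Hin (-t) := by
    have := timeUnitary_mul_neg K (-t)
    rw [hC, conjTranspose_mul, conjTranspose_mul, timeUnitary_conjTranspose hHin,
      timeUnitary_conjTranspose hK, ← hW]
    simp only [Matrix.mul_assoc]
    rw [← Matrix.mul_assoc (timeUnitary K (-t)), this, Matrix.one_mul]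
  -- The tensor powers of `W` and `C` purify the input and its translate; covariance then moves the
  -- translation through `Φ`.
  have hcs := hΦ.norm_trace_le_sum_sqrt V hVV' (tensorPow W n) (tensorPow C n)
  rw [tensorPow_conjTranspose, tensorPow_conjTranspose, tensorPow_mul, tensorPow_mul,
    tensorPow_mul, trace_tensorPow, norm_pow, hW, hCC, ← timeTranslation_tensorPow, ← hcov] at hcs
  have hσt := posSemidef_timeUnitary_conj hHout hσ.1 t
  have hpos {X : Matrix b b ℂ} (hX : X.PosSemidef) : (Mᴴ * X * M).PosSemidef :=
    hX.conjTranspose_mul_mul_same M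
  have hpos' {X : Matrix (Fin m → b) (Fin m → b) ℂ} (hX : X.PosSemidef) (y : Fin m → b) :
      0 ≤ ((Vᴴ * X * V) y y).re :=
    (Complex.le_def.1 (hX.conjTranspose_mul_mul_same V).diag_nonneg).1
  have htt : (timeTranslation Hout m t (Φ (tensorPow ρ n))).PosSemidef := by
    rw [hcov, timeTranslation_tensorPow]
    exact hΦ.posSemidef (posSemidef_tensorPow (posSemidef_timeUnitary_conj hHin hρ.1 t) n)
  have hΦρ := hΦ.posSemidef (posSemidef_tensorPow hρ.1 n)
  rw [← sum_sqrt_diag_tensorPow (hpos hσ.1) (hpos hσt)]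
  refine hcs.trans ?_
  simp only [← hdiag]
  rw [← timeTranslation_tensorPow]
  have hσm := posSemidef_tensorPow hσ.1 m
  have hU := tensorPow_mul (timeUnitary Hout t) (timeUnitary Hout (-t)) m
  rw [timeUnitary_mul_neg, tensorPow_one] at hU
  have hUstar : (tensorPow (timeUnitary Hout (-t)) m)ᴴ = tensorPow (timeUnitary Hout t) m := by
    rw [tensorPow_conjTranspose, timeUnitary_conjTranspose hHout, neg_neg]
  refine sum_sqrt_mul_sqrt_le_add (hpos' hΦρ) (hpos' htt) (hpos' hσm) (hpos' ?_) ?_ ?_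
    (sum_abs_re_diag_sub_le hVV hdist) ?_
  · rw [timeTranslation, ← hUstar]
    exact hσm.conjTranspose_mul_mul_same _
  · rw [re_trace_conj hVV', hcov, hΦ.tracePreserving, timeTranslation_tensorPow, trace_tensorPow,
      trace_timeUnitary_conj, hρ.2]
    simp
  · rw [re_trace_conj hVV', trace_tensorPow, hσ.2]
    simp
  -- Measuring translated states in the basis `V` is measuring the original ones in the back-rotated
  -- basis, so the same error bound applies.
  · have h2 := sum_abs_re_diag_sub_le (V := tensorPow (timeUnitary Hout (-t)) m * V) (ε := ε)
      (X := Φ (tensorPow ρ n)) (Y := tensorPow σ m) ?_ hdist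
    · simpa only [conjTranspose_mul, hUstar, timeTranslation, Matrix.mul_assoc] using h2
    · rw [conjTranspose_mul, hUstar, Matrix.mul_assoc, ← Matrix.mul_assoc _ _ V, hU,
        Matrix.one_mul, hVV]

/-- Measuring the symmetric logarithmic derivative attains the quantum Fisher information. -/
lemma exists_measurement {H σ : Matrix b b ℂ} (hH : H.IsHermitian) (hσ : IsDensity σ) :
    ∃ M : Matrix b b ℂ, Mᴴ * M = 1 ∧ M * Mᴴ = 1 ∧ ∃ ψ : ℝ → ℝ,
      (∀ᶠ t in 𝓝[≠] 0, ∑ x, √((Mᴴ * σ * M) x x).re *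
        √((Mᴴ * (timeUnitary H t * σ * timeUnitary H (-t)) * M) x x).re ≤ 1 + t ^ 2 * ψ t) ∧
      Tendsto ψ (𝓝[≠] 0) (𝓝 (-fisherInfo H σ hσ.isHermitian / 8)) := by
  obtain ⟨L, hL, h1, h2, h3⟩ := exists_symmetric_logarithmic_derivative hH hσ
  obtain ⟨M, hM, hM', hLM, -⟩ := exists_eigenbasis hL
  refine ⟨M, hM, hM', ?_⟩
  set s := hL.eigenvalues
  set F := fisherInfo H σ hσ.isHermitian
  let q (t : ℝ) (x : b) : ℝ :=
    -- Outcome probabilities in the eigenbasis of `L`. The eigenvalues of `L` serve as the score, so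
    -- its expectation is `tr (L σ_t)`, with derivative `F` at `0`.
    ((Mᴴ * (timeUnitary H t * σ * timeUnitary H (-t)) * M) x x).re
  have hq0 (x : b) : q 0 x = ((Mᴴ * σ * M) x x).re := by simp [q, timeUnitary_zero]
  have htr (X : Matrix b b ℂ) (v : b → ℝ) :
      ∑ x, ((Mᴴ * X * M) x x).re * v x =
        (X * (M * diagonal (fun i => (v i : ℂ)) * Mᴴ)).trace.re := by
    rw [trace_mul_conj, trace, Complex.re_sum]
    simp [mul_diagonal]
  have hLL : L * L = M * diagonal (fun i => ((s i ^ 2 : ℝ) : ℂ)) * Mᴴ := by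
    have e : diagonal (fun i => ((s i ^ 2 : ℝ) : ℂ)) =
        diagonal (fun i => (s i : ℂ)) * diagonal (fun i => (s i : ℂ)) := by
      rw [diagonal_mul_diagonal]; simp [sq]
    rw [e, hLM]
    simp only [Matrix.mul_assoc]
    rw [← Matrix.mul_assoc Mᴴ, hM, Matrix.one_mul]
  have hre {f : ℝ → ℂ} {z : ℂ} (hf : HasDerivAt f z 0) : HasDerivAt (fun t => (f t).re) z.re 0 :=
    Complex.reCLM.hasFDerivAt.comp_hasDerivAt (0 : ℝ) hf
  have key := exists_bhattacharyya_bound (q := q) (s := s) (F := F) ?_ ?_ ?_ ?_ ?_ ?_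
  · simpa only [hq0] using key
  · exact fun t x => (Complex.le_def.1 ((posSemidef_timeUnitary_conj hH hσ.1
      t).conjTranspose_mul_mul_same M).diag_nonneg).1
  · intro t
    rw [re_trace_conj hM', trace_timeUnitary_conj, hσ.2, Complex.one_re]
  · intro x
    let D : Matrix b b ℂ →ₗ[ℂ] ℂ :=
      { toFun := fun X => (Mᴴ * X * M) x x
        map_add' := fun X Y => by simp [Matrix.mul_add, Matrix.add_mul]
        map_smul' := fun r X => by simp }
    exact (hre (hasDerivAt_timeUnitary_zero H D σ)).continuousAt
  · simp only [hq0]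
    rw [htr, ← hLM, trace_mul_comm, h1, Complex.zero_re]
  · simp only [hq0]
    rw [htr σ fun x => s x ^ 2, ← hLL, trace_mul_comm, h2, Complex.ofReal_re]
  · have h := hre (hasDerivAt_timeUnitary_zero H
      (traceLinearMap b ℂ ℂ ∘ₗ LinearMap.mulLeft ℂ L) σ)
    simp only [LinearMap.comp_apply, LinearMap.mulLeft_apply, traceLinearMap_apply, h3,
      Complex.ofReal_re] at h
    refine h.congr_of_eventuallyEq (Eventually.of_forall fun t => ?_)
    change ∑ x, q t x * s x = _
    rw [htr, ← hLM, trace_mul_comm]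

end Conversion

/-! ### Many-copy limit and optimisation -/

section Asymptotics

variable {a b : Type*} [Fintype a] [DecidableEq a] [Fintype b] [DecidableEq b]

lemma exp_sub_exp_le_of_TIConvertible {Hin ρ : Matrix a a ℂ} {Hout σ : Matrix b b ℂ}
    (hHin : Hin.IsHermitian) (hHout : Hout.IsHermitian) (hρ : IsDensity ρ) (hσ : IsDensity σ)
    {R δ : ℝ} (hR : 0 ≤ R)
    (h : ∀ᶠ n : ℕ in atTop, TIConvertible Hin ρ Hout σ n ⌈R * (n : ℝ)⌉₊ δ) {s : ℝ} (hs : s ≠ 0) :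
    Real.exp (s ^ 2 * (-fisherInfo Hin ρ hρ.isHermitian / 8)) ≤
      Real.exp (R * s ^ 2 * (-fisherInfo Hout σ hσ.isHermitian / 8)) + 4 * √δ := by
  obtain ⟨W, K, hW, hK, e1, e2⟩ := exists_purification hHin hρ
  obtain ⟨M, hM, hM', ψ, hψ, hψlim⟩ := exists_measurement hHout hσ
  have hov := tendsto_overlap_second_order (by rw [hW, hρ.2]) e1 e2
  set ov : ℝ → ℂ := fun t => (timeUnitary Hin t * W * timeUnitary K (-t) * Wᴴ).trace
  -- At this scale `n t²` stays fixed, so `n`-th powers of `1 - c t²` have nontrivial limits.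
  let t : ℕ → ℝ := fun n => s / √n
  have ht2 (n : ℕ) : t n ^ 2 = s ^ 2 / n := by rw [div_pow, Real.sq_sqrt n.cast_nonneg]
  have ht : Tendsto t atTop (𝓝[≠] 0) := by
    refine tendsto_nhdsWithin_iff.2 ⟨tendsto_const_nhds.div_atTop
      (Real.tendsto_sqrt_atTop.comp tendsto_natCast_atTop_atTop), ?_⟩
    filter_upwards [eventually_gt_atTop 0] with n hn
    exact div_ne_zero hs (Real.sqrt_pos.2 (Nat.cast_pos.2 hn)).ne'
  have hin : Tendsto (fun n : ℕ => ‖ov (t n)‖ ^ n) atTop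
      (𝓝 (Real.exp (s ^ 2 * (-fisherInfo Hin ρ hρ.isHermitian / 8)))) := by
    have h1 : Tendsto (fun n : ℕ => (n : ℂ) * (ov (t n) - 1)) atTop
        (𝓝 ((s ^ 2 * (-fisherInfo Hin ρ hρ.isHermitian / 8) : ℝ) : ℂ)) := by
      rw [Complex.ofReal_mul]
      refine ((hov.comp ht).const_mul ((s ^ 2 : ℝ) : ℂ)).congr' ?_
      filter_upwards [eventually_gt_atTop 0] with n hn
      have hn' : (n : ℂ) ≠ 0 := Nat.cast_ne_zero.2 hn.ne'
      have hs' : (s : ℂ) ≠ 0 := by exact_mod_cast hs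
      have : ((t n : ℂ)) ^ 2 = (s : ℂ) ^ 2 / n := by exact_mod_cast ht2 n
      simp only [Function.comp_apply, this]
      push_cast
      field_simp
      rfl
    have h2 := (Complex.tendsto_one_add_pow_exp_of_tendsto h1).norm
    rw [Complex.norm_exp, Complex.ofReal_re] at h2
    refine h2.congr fun n => ?_
    rw [norm_pow, add_sub_cancel]
  have hout : Tendsto (fun n : ℕ => Real.exp (((⌈R * (n : ℝ)⌉₊ : ℝ) / n * s ^ 2) * ψ (t n)) +
      4 * √δ) atTop
      (𝓝 (Real.exp (R * s ^ 2 * (-fisherInfo Hout σ hσ.isHermitian / 8)) + 4 * √δ)) := by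
    have h1 : Tendsto (fun n : ℕ => (⌈R * (n : ℝ)⌉₊ : ℝ) / n) atTop (𝓝 R) :=
      (tendsto_nat_ceil_mul_div_atTop hR).comp tendsto_natCast_atTop_atTop
    exact ((Real.continuous_exp.tendsto _).comp
      ((h1.mul_const _).mul (hψlim.comp ht))).add_const _
  refine le_of_tendsto_of_tendsto hin hout ?_
  filter_upwards [h, ht.eventually hψ] with n hn hb
  have h1 := hn.norm_overlap_pow_le hHin hHout hρ hσ hW hK hM hM' (t n)
  refine h1.trans (add_le_add_left ?_ _)
  have h0 : 0 ≤ ∑ x, √((Mᴴ * σ * M) x x).re *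
        √((Mᴴ * (timeUnitary Hout (t n) * σ * timeUnitary Hout (-t n)) * M) x x).re :=
    Finset.sum_nonneg fun x _ => mul_nonneg (Real.sqrt_nonneg _) (Real.sqrt_nonneg _)
  have h2 := hb.trans ((add_comm _ _).trans_le (Real.add_one_le_exp _))
  refine (pow_le_pow_left₀ h0 h2 _).trans_eq ?_
  rw [← Real.exp_nat_mul, ht2]
  congr 1
  ring

lemma rpow_sub_le_of_TIConvertible {Hin ρ : Matrix a a ℂ} {Hout σ : Matrix b b ℂ}
    (hHin : Hin.IsHermitian) (hHout : Hout.IsHermitian) (hρ : IsDensity ρ) (hσ : IsDensity σ)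
    (hF : 0 < fisherInfo Hout σ hσ.isHermitian) {R δ : ℝ} (hR : 0 < R)
    (h : ∀ᶠ n : ℕ in atTop, TIConvertible Hin ρ Hout σ n ⌈R * (n : ℝ)⌉₊ δ) {u : ℝ} (hu : 0 < u)
    (hu1 : u < 1) :
    u ^ (fisherInfo Hin ρ hρ.isHermitian / (R * fisherInfo Hout σ hσ.isHermitian)) - u ≤
      4 * √δ := by
  set Fi := fisherInfo Hin ρ hρ.isHermitian with hFi
  set Fo := fisherInfo Hout σ hσ.isHermitian with hFo
  have hlog : Real.log u < 0 := Real.log_neg hu hu1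
  -- This is the value of `s²` for which the output exponential equals `u`.
  have hpos : 0 < -8 * Real.log u / (R * Fo) :=
    div_pos (by linarith) (mul_pos hR hF)
  have key := exp_sub_exp_le_of_TIConvertible hHin hHout hρ hσ hR.le h
    (Real.sqrt_pos.2 hpos).ne'
  rw [← hFi, ← hFo, Real.sq_sqrt hpos.le] at key
  have e1 : R * (-8 * Real.log u / (R * Fo)) * (-Fo / 8) = Real.log u := by
    field_simp
  have e2 : -8 * Real.log u / (R * Fo) * (-Fi / 8) = Real.log u * (Fi / (R * Fo)) := by
    field_simp
  rw [e1, e2, Real.exp_log hu, ← Real.rpow_def_of_pos hu] at key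
  linarith

/-- For `0 < T < 1` the function `u ^ T - u` is stationary where `T u ^ (T - 1) = 1`, that is at `u
= T ^ (1 / (1 - T))`, with value `gapFun T`. For `T ≥ 1` the gap is nonpositive. -/
lemma gapFun_le {T c : ℝ} (hT : 0 ≤ T) (hc : 0 ≤ c)
    (h : ∀ u : ℝ, 0 < u → u < 1 → u ^ T - u ≤ c) : gapFun T ≤ c := by
  unfold gapFun
  rcases hT.eq_or_lt with rfl | hT0
  · have : (0 : ℝ) ^ ((0 : ℝ) / (1 - 0)) - 0 ^ ((1 : ℝ) / (1 - 0)) = 1 := by norm_num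
    rw [this]
    by_contra! hc1
    -- At `T = 0` the supremum `1` is approached as `u → 0` but not attained, so a `u` below `1 - c`
    -- is used.
    have := h ((1 - c) / 2) (by linarith) (by linarith)
    rw [Real.rpow_zero] at this
    linarith
  rcases lt_trichotomy T 1 with hT1 | rfl | hT1
  · have h1 : 0 < 1 - T := by linarith
    have := h (T ^ (1 / (1 - T))) (Real.rpow_pos_of_pos hT0 _)
      (Real.rpow_lt_one hT hT1 (by positivity))
    rwa [← Real.rpow_mul hT, one_div_mul_eq_div] at this
  · simpa using hc
  · have h1 : 1 - T < 0 := by linarith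
    have : T ^ (T / (1 - T)) ≤ T ^ (1 / (1 - T)) :=
      Real.rpow_le_rpow_of_exponent_le hT1.le (div_le_div_of_nonpos_of_le h1.le hT1.le)
    linarith

end Asymptotics

end QuantumIID

end

open QuantumIID in
theorem mainTheorem3 {a b : Type*} [Fintype a] [DecidableEq a] [Fintype b] [DecidableEq b]
    (Hin ρ : Matrix a a ℂ) (Hout σ : Matrix b b ℂ)
    (hHin : Hin.IsHermitian) (hHout : Hout.IsHermitian)
    (hρ : QuantumIID.IsDensity ρ) (hσ : QuantumIID.IsDensity σ)
    (hF : 0 < QuantumIID.fisherInfo Hout σ hσ.isHermitian)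
    (R : ℝ) (hR : 0 < R) :
    (∀ δ : ℝ,
      (∃ n₀ : ℕ, ∀ n ≥ n₀,
        QuantumIID.TIConvertible Hin ρ Hout σ n ⌈R * (n : ℝ)⌉₊ δ) →
      QuantumIID.gapFun
        (QuantumIID.fisherInfo Hin ρ hρ.isHermitian /
          (R * QuantumIID.fisherInfo Hout σ hσ.isHermitian)) ≤ 4 * √δ) ∧
    (QuantumIID.AchievableRate Hin ρ Hout σ R →
      R ≤ QuantumIID.fisherInfo Hin ρ hρ.isHermitian /
        QuantumIID.fisherInfo Hout σ hσ.isHermitian) := by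
  constructor
  · rintro δ ⟨n₀, hn₀⟩
    refine gapFun_le (div_nonneg (fisherInfo_nonneg hρ) (mul_pos hR hF).le) (by positivity)
      fun u hu hu1 => ?_
    exact rpow_sub_le_of_TIConvertible hHin hHout hρ hσ hF hR (eventually_atTop.2 ⟨n₀, hn₀⟩) hu hu1
  · rintro ⟨ε, hε, n₀, hn₀⟩
    by_contra! hlt
    set T := fisherInfo Hin ρ hρ.isHermitian / (R * fisherInfo Hout σ hσ.isHermitian) with hT
    have hT1 : T < 1 := by
      rw [div_lt_iff₀ hF] at hlt
      rwa [hT, div_lt_one (mul_pos hR hF)]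
    -- The gap at `u = 1/2`, positive since `T < 1`. Eventually the error is at most `(κ / 8)²`, and
    -- then `4 √δ = κ / 2 < κ` is a contradiction.
    set κ := (1 / 2 : ℝ) ^ T - 1 / 2 with hκ
    have hκ0 : 0 < κ := by
      have := Real.rpow_lt_rpow_of_exponent_gt (x := (1 / 2 : ℝ)) (by norm_num) (by norm_num) hT1
      rw [Real.rpow_one] at this
      linarith
    have hconv : ∀ᶠ n : ℕ in atTop,
        TIConvertible Hin ρ Hout σ n ⌈R * (n : ℝ)⌉₊ ((κ / 8) ^ 2) := by
      filter_upwards [hε.eventually (ge_mem_nhds (show (0 : ℝ) < (κ / 8) ^ 2 by positivity)),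
        eventually_ge_atTop n₀] with n h1 h2
      obtain ⟨Φ, hΦ, hcov, hd⟩ := hn₀ n h2
      exact ⟨Φ, hΦ, hcov, hd.trans h1⟩
    have := rpow_sub_le_of_TIConvertible hHin hHout hρ hσ hF hR hconv
      (u := 1 / 2) (by norm_num) (by norm_num)
    rw [Real.sqrt_sq (by positivity), ← hT, ← hκ] at this
    linarith
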